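/- A \emph{1D-QAC circuit of depth $d$} on a line of $N$ qubits is a product $C=L_dM_d\cdots L_1M_1L_0$, where each $L_k$ is a tensor product of arbitrary single-qubit unitaries, and each $M_k$ is a product of multi-qubit $CZ$ gates whose supports are pairwise disjoint contiguous intervals of the line, of any size (the $CZ$ gate with support $S$ maps a computational basis state $|y\rangle$ to $-|y\rangle$ if $y_i=1$ for all $i\in S$, and to $|y\rangle$ otherwise). Suppose that $n$ of the $N$ qubits are input qubits and that the input qubits form a contiguous interval of the line. The other $N-n$ qubits are ancillas; their number is arbitrary, and they start in an arbitrary fixed pure state $|\varphi\rangle$, independent of the input. On input $x\in\{0,1\}^n$ the circuit is applied to $|x\rangle\otimes|\varphi\rangle$ and then one fixed output qubit, which may be any qubit of the line, is measured in the computational basis; let $g_C(x)\in\{0,1\}$ be the outcome. Write $\mathrm{PARITY}_n(x)=x_1\oplus\cdots\oplus x_n$. Theorem. Let $n,d\ge 1$ be integers. For every such circuit $C$ of depth $d$ with $n$ contiguous input qubits, $$\Pr_{x,C}\bigl[g_C(x)=\mathrm{PARITY}_n(x)\bigr]\;\le\;\frac12+8dn\cdot 2^{-n/(10d)},$$ where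 $x$ is uniform on $\{0,1\}^n$ and the probability is also over the measurement. In particular, depth $\Omega(n/\log n)$ is needed to compute $\mathrm{PARITY}_n$ with average-case probability at least $2/3$: there is an absolute constant $c>0$ such that for every $n\ge 2$, every such circuit with $\Pr_{x,C}[g_C(x)=\mathrm{PARITY}_n(x)]\ge \frac23$, whatever its number of ancillas and their initial state, has depth at least $c\,n/\log n$. -/

import Mathlib

/-- A computational basis string of a line of `N` qubits. -/
abbrev Bits (N : ℕ) : Type := Fin N → Fin 2

/-- Operators on the `2 ^ N`-dimensional space of `N` qubits, as matrices in the computational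
basis. -/
abbrev QOp (N : ℕ) : Type := Matrix (Bits N) (Bits N) ℂ

/-- A layer of single-qubit unitaries: one arbitrary unitary for each qubit. -/
abbrev SingleLayer (N : ℕ) : Type := Fin N → Matrix.unitaryGroup (Fin 2) ℂ

/-- The operator of a layer of single-qubit unitaries: the tensor product `⨂ i, L i`. -/
def SingleLayer.op {N : ℕ} (L : SingleLayer N) : QOp N :=
  Matrix.of fun y z => ∏ i, (L i : Matrix (Fin 2) (Fin 2) ℂ) (y i) (z i)

/-- The multi-qubit controlled-`Z` gate with support `S`: it flips the sign of the basis vectors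
whose bits in `S` are all `1`, and fixes the other basis vectors. -/
def czGate {N : ℕ} (S : Finset (Fin N)) : QOp N :=
  Matrix.diagonal fun y => if ∀ i ∈ S, y i = 1 then -1 else 1

/-- A layer of controlled-`Z` gates on a line of `N` qubits: the supports of the gates are nonempty
contiguous intervals of any size, and they are pairwise disjoint. -/
structure CZLayer (N : ℕ) where
  gates : List (Finset (Fin N))
  interval : ∀ S ∈ gates, ∃ a b : Fin N, a ≤ b ∧ S = Finset.Icc a b
  disjoint : gates.Pairwise Disjoint

/-- The operator of a layer of controlled-`Z` gates: the product of the (commuting) gates. -/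
def CZLayer.op {N : ℕ} (M : CZLayer N) : QOp N :=
  (M.gates.map czGate).prod

/-- One-dimensional QAC circuits `L_d M_d ⋯ L_1 M_1 L_0` on a line of `N` qubits, indexed by their
depth `d`, the number of layers of controlled-`Z` gates. -/
inductive OneDQAC (N : ℕ) : ℕ → Type
  | init (L : SingleLayer N) : OneDQAC N 0
  | layer {d : ℕ} (C : OneDQAC N d) (M : CZLayer N) (L : SingleLayer N) : OneDQAC N (d + 1)

/-- The operator computed by a circuit. -/
def OneDQAC.op {N : ℕ} : {d : ℕ} → OneDQAC N d → QOp N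
  | _, .init L => L.op
  | _, .layer C M L => L.op * M.op * C.op

/-- A placement of `n` input qubits on a line of `N` qubits is contiguous if the qubits that it
occupies form an interval of the line. -/
def IsContiguous {n N : ℕ} (e : Fin n ↪ Fin N) : Prop :=
  (Set.range e).OrdConnected

/-- The ancilla qubits: those that hold no input bit. -/
abbrev Ancilla {n N : ℕ} (e : Fin n ↪ Fin N) : Type := {q : Fin N // q ∉ Set.range e}

/-- The space of pure states of the ancilla qubits. -/
abbrev AncillaState {n N : ℕ} (e : Fin n ↪ Fin N) : Type :=
  EuclideanSpace ℂ (Ancilla e → Fin 2)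

/-- The initial state `|x⟩ ⊗ |φ⟩`, with `|x⟩` on the input qubits and `|φ⟩` on the ancilla qubits. -/
noncomputable def initialState {n N : ℕ} (e : Fin n ↪ Fin N) (φ : AncillaState e) (x : Bits n) :
    Bits N → ℂ :=
  fun y => if ∀ i, y (e i) = x i then φ (fun q => y q) else 0

/-- The probability that measuring qubit `q` of the state `ψ` in the computational basis gives the
outcome `b`. -/
noncomputable def measureProb {N : ℕ} (ψ : Bits N → ℂ) (q : Fin N) (b : Fin 2) : ℝ :=
  ∑ y : Bits N with y q = b, ‖ψ y‖ ^ 2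

/-- The parity of a bit string: the sum of its bits modulo `2`. -/
def parity {n : ℕ} (x : Bits n) : Fin 2 := ∑ i, x i

/-- The average-case probability that the circuit `C`, with inputs placed by `e`, ancilla state `φ`
and output qubit `q`, computes the parity of its input: the probability, over a uniformly random
input `x` and the final measurement, that the outcome is the parity of `x`. -/
noncomputable def paritySuccess {n N d : ℕ} (C : OneDQAC N d) (e : Fin n ↪ Fin N)
    (φ : AncillaState e) (q : Fin N) : ℝ :=
  (∑ x : Bits n, measureProb (C.op.mulVec (initialState e φ x)) q (parity x)) / 2 ^ n

/-!
Fix `k` and delete from the circuit every controlled-`Z` gate whose support contains `k` consecutive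
qubits well inside the input interval, at distance at least `k * t` from its ends for a gate in the
layer number `t`, counted from `0`. In the Heisenberg picture the remaining layers spread an
observable by at most `k` qubits each, so before such a gate acts, the observables on those `k`
qubits depend on input qubits only, and a uniformly random input makes the state of these qubits
maximally mixed. Hence the gate acts nontrivially on only a fraction `2 ^ (-k)` of the squared norm,
and each layer has at most `n` of these gates because their supports are disjoint. In the pruned
circuit the light cone of the output qubit has radius `d * k < n / 2`, so it misses the first or the
last input qubit; flipping that qubit flips the parity but not the distribution of the output, and
the pruned circuit succeeds with probability exactly `1 / 2`.
-/

open Matrix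

section FrobeniusNorm

open scoped Matrix.Norms.Frobenius

variable {l m n 𝕜 : Type*} [Fintype l] [Fintype m] [Fintype n] [RCLike 𝕜]

theorem frobenius_norm_sq (A : Matrix m n 𝕜) : ‖A‖ ^ 2 = ∑ i, ∑ j, ‖A i j‖ ^ 2 := by
  rw [frobenius_norm_def, ← Real.sqrt_eq_rpow, Real.sq_sqrt (by positivity)]
  simp only [Real.rpow_two]

theorem frobenius_norm_le_of_forall_norm_le {A B : Matrix m n 𝕜}
    (h : ∀ i j, ‖A i j‖ ≤ ‖B i j‖) : ‖A‖ ≤ ‖B‖ := by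
  rw [← sq_le_sq₀ (norm_nonneg _) (norm_nonneg _), frobenius_norm_sq, frobenius_norm_sq]
  gcongr
  exact h _ _

theorem trace_conjTranspose_mul_self_eq_frobenius_norm_sq (A : Matrix m n 𝕜) :
    (Aᴴ * A).trace = ((‖A‖ ^ 2 : ℝ) : 𝕜) := by
  rw [frobenius_norm_sq, Finset.sum_comm]
  simp only [trace, diag_apply, mul_apply, conjTranspose_apply, RCLike.star_def, RCLike.conj_mul,
    RCLike.ofReal_sum, RCLike.ofReal_pow]

theorem frobenius_norm_mul_of_isometry [DecidableEq m] {V : Matrix l m 𝕜} (hV : Vᴴ * V = 1)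
    (A : Matrix m n 𝕜) : ‖V * A‖ = ‖A‖ := by
  have h : ((‖V * A‖ ^ 2 : ℝ) : 𝕜) = ((‖A‖ ^ 2 : ℝ) : 𝕜) := by
    rw [← trace_conjTranspose_mul_self_eq_frobenius_norm_sq,
      ← trace_conjTranspose_mul_self_eq_frobenius_norm_sq, conjTranspose_mul, Matrix.mul_assoc,
      ← Matrix.mul_assoc Vᴴ, hV, Matrix.one_mul]
  exact (sq_eq_sq₀ (norm_nonneg _) (norm_nonneg _)).1 (RCLike.ofReal_injective h)

theorem frobenius_norm_unitary_mul [DecidableEq m] {U : Matrix m m 𝕜} (hU : U ∈ unitaryGroup m 𝕜)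
    (A : Matrix m n 𝕜) : ‖U * A‖ = ‖A‖ :=
  frobenius_norm_mul_of_isometry (mem_unitaryGroup_iff'.1 hU) A

theorem frobenius_norm_sq_of_isometry [DecidableEq n] {V : Matrix m n 𝕜} (hV : Vᴴ * V = 1) :
    ‖V‖ ^ 2 = Fintype.card n := by
  have h := trace_conjTranspose_mul_self_eq_frobenius_norm_sq V
  rw [hV, trace_one] at h
  exact_mod_cast h.symm

theorem frobenius_norm_prod_sub_prod_filter_mul_le [DecidableEq m] {α : Type*}
    {u : α → Matrix m m 𝕜} (hu : ∀ s, u s ∈ unitaryGroup m 𝕜) (hcomm : ∀ s t, Commute (u s) (u t))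
    (p : α → Prop) [DecidablePred p] (A : Matrix m n 𝕜) {δ : ℝ} (gates : List α)
    (hδ : ∀ s ∈ gates, p s → ‖(u s - 1) * A‖ ≤ δ) :
    ‖((gates.map u).prod - ((gates.filter (¬p ·)).map u).prod) * A‖ ≤ gates.countP p * δ := by
  induction gates with
  | nil => simp
  | cons s gates ih =>
    specialize ih fun t ht => hδ t (List.mem_cons_of_mem s ht)
    set V := (gates.map u).prod
    set W := ((gates.filter (¬p ·)).map u).prod
    have hWmem : W ∈ unitaryGroup m 𝕜 :=
      list_prod_mem (List.forall_mem_map.2 fun t _ => hu t)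
    have hWcomm : Commute W (u s) :=
      Commute.list_prod_left _ _ (List.forall_mem_map.2 fun t _ => hcomm t s)
    by_cases hs : p s
    · have htelescope : (u s * V - W) * A = u s * ((V - W) * A) + W * ((u s - 1) * A) := by
        simp only [← Matrix.mul_assoc, ← Matrix.add_mul, Matrix.mul_sub, hWcomm.eq, Matrix.mul_one,
          sub_add_sub_cancel]
      rw [List.map_cons, List.prod_cons, List.filter_cons_of_neg (by simpa using hs), htelescope,
        List.countP_cons_of_pos (by simpa using hs), Nat.cast_succ, add_one_mul]
      calc ‖u s * ((V - W) * A) + W * ((u s - 1) * A)‖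
          ≤ ‖u s * ((V - W) * A)‖ + ‖W * ((u s - 1) * A)‖ := norm_add_le _ _
        _ = ‖(V - W) * A‖ + ‖(u s - 1) * A‖ := by
          rw [frobenius_norm_unitary_mul (hu s), frobenius_norm_unitary_mul hWmem]
        _ ≤ gates.countP p * δ + δ := add_le_add ih (hδ s List.mem_cons_self hs)
    · rw [List.map_cons, List.prod_cons, List.filter_cons_of_pos (by simpa using hs),
        List.map_cons, List.prod_cons, ← Matrix.mul_sub, Matrix.mul_assoc,
        frobenius_norm_unitary_mul (hu s), List.countP_cons_of_neg (by simpa using hs)]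
      exact ih

end FrobeniusNorm

section TensorProducts

variable {ι 𝕜 κ : Type*} [Fintype ι] [CommSemiring 𝕜]

/-- The tensor product `⨂ i, f i` of a family of square matrices, as a matrix on the product basis
`ι → κ`. -/
def tensorOp (f : ι → Matrix κ κ 𝕜) : Matrix (ι → κ) (ι → κ) 𝕜 :=
  Matrix.of fun y z => ∏ i, f i (y i) (z i)

theorem tensorOp_apply (f : ι → Matrix κ κ 𝕜) (y z : ι → κ) :
    tensorOp f y z = ∏ i, f i (y i) (z i) := rfl

theorem tensorOp_conjTranspose [StarRing 𝕜] (f : ι → Matrix κ κ 𝕜) :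
    (tensorOp f)ᴴ = tensorOp fun i => (f i)ᴴ := by
  ext y z
  simp only [conjTranspose_apply, tensorOp_apply, star_prod]

theorem tensorOp_diagonal [DecidableEq κ] (v : ι → κ → 𝕜) :
    tensorOp (fun i => diagonal (v i)) = diagonal fun y => ∏ i, v i (y i) := by
  ext y z
  by_cases h : y = z
  · simp only [h, tensorOp_apply, diagonal_apply_eq]
  · obtain ⟨i, hi⟩ := Function.ne_iff.1 h
    rw [diagonal_apply_ne _ h]
    exact Finset.prod_eq_zero (Finset.mem_univ i) (diagonal_apply_ne _ hi)

theorem tensorOp_one [DecidableEq κ] : tensorOp (1 : ι → Matrix κ κ 𝕜) = 1 :=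
  (tensorOp_diagonal fun _ _ => 1).trans <| by simp only [Finset.prod_const_one, diagonal_one]

variable [DecidableEq ι] [Fintype κ]

theorem tensorOp_mul (f g : ι → Matrix κ κ 𝕜) : tensorOp f * tensorOp g = tensorOp (f * g) := by
  ext y z
  simp only [mul_apply, tensorOp_apply, Pi.mul_apply, ← Finset.prod_mul_distrib]
  exact (Fintype.prod_sum fun i b => f i (y i) b * g i b (z i)).symm

theorem trace_tensorOp (f : ι → Matrix κ κ 𝕜) : (tensorOp f).trace = ∏ i, (f i).trace :=
  (Fintype.prod_sum fun i b => f i b b).symm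

variable [DecidableEq κ]

variable (𝕜 κ) in
/-- The algebra of operators supported on the tensor factors in `S`, spanned by the tensor products
that are trivial on all other factors. -/
def localAlgebra (S : Finset ι) : Subalgebra 𝕜 (Matrix (ι → κ) (ι → κ) 𝕜) :=
  (Submodule.span 𝕜 {A | ∃ f : ι → Matrix κ κ 𝕜, (∀ i ∉ S, f i = 1) ∧ tensorOp f = A}).toSubalgebra
    (Submodule.subset_span ⟨1, fun _ _ => rfl, tensorOp_one⟩) fun A B hA hB => by
      have hAB := Submodule.mul_mem_mul hA hB
      rw [Submodule.span_mul_span] at hAB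
      refine Submodule.span_mono ?_ hAB
      rintro _ ⟨_, ⟨f, hf, rfl⟩, _, ⟨g, hg, rfl⟩, rfl⟩
      refine ⟨f * g, fun i hi => ?_, (tensorOp_mul f g).symm⟩
      rw [Pi.mul_apply, hf i hi, hg i hi, Matrix.one_mul]

variable {S T : Finset ι} {A B : Matrix (ι → κ) (ι → κ) 𝕜}

theorem tensorOp_mem_localAlgebra {f : ι → Matrix κ κ 𝕜} (hf : ∀ i ∉ S, f i = 1) :
    tensorOp f ∈ localAlgebra 𝕜 κ S :=
  Submodule.subset_span ⟨f, hf, rfl⟩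

@[elab_as_elim]
theorem localAlgebra_induction {p : (A : Matrix (ι → κ) (ι → κ) 𝕜) → A ∈ localAlgebra 𝕜 κ S → Prop}
    (tensor : ∀ f (hf : ∀ i ∉ S, f i = 1), p (tensorOp f) (tensorOp_mem_localAlgebra hf))
    (zero : p 0 (zero_mem _))
    (add : ∀ A B hA hB, p A hA → p B hB → p (A + B) (add_mem hA hB))
    (smul : ∀ (c : 𝕜) (A hA), p A hA → p (c • A) (Subalgebra.smul_mem _ hA c))
    (hA : A ∈ localAlgebra 𝕜 κ S) : p A hA := by
  refine Submodule.span_induction ?_ zero add smul hA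
  rintro _ ⟨f, hf, rfl⟩
  exact tensor f hf

theorem localAlgebra_mono (h : S ⊆ T) : localAlgebra 𝕜 κ S ≤ localAlgebra 𝕜 κ T :=
  Submodule.span_mono fun _ ⟨f, hf, hA⟩ => ⟨f, fun i hi => hf i (mt (@h i) hi), hA⟩

theorem commute_of_mem_localAlgebra_of_disjoint (h : Disjoint S T) (hA : A ∈ localAlgebra 𝕜 κ S)
    (hB : B ∈ localAlgebra 𝕜 κ T) : Commute A B := by
  induction hA using localAlgebra_induction with
  | zero => exact Commute.zero_left B
  | add _ _ _ _ hA hA' => exact hA.add_left hA'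
  | smul c _ _ hA => exact hA.smul_left c
  | tensor f hf =>
    induction hB using localAlgebra_induction with
    | zero => exact Commute.zero_right _
    | add _ _ _ _ hB hB' => exact hB.add_right hB'
    | smul c _ _ hB => exact hB.smul_right c
    | tensor g hg =>
      have hfg : f * g = g * f := funext fun i => by
        by_cases hi : i ∈ S
        · simp [hg i (Finset.disjoint_left.1 h hi)]
        · simp [hf i hi]
      rw [Commute, SemiconjBy, tensorOp_mul, tensorOp_mul, hfg]

theorem apply_self_congr_of_mem_localAlgebra (hA : A ∈ localAlgebra 𝕜 κ S) {y z : ι → κ}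
    (h : ∀ i ∈ S, y i = z i) : A y y = A z z := by
  induction hA using localAlgebra_induction with
  | zero => rfl
  | add _ _ _ _ hA hB => rw [Matrix.add_apply, Matrix.add_apply, hA, hB]
  | smul c _ _ hA => rw [Matrix.smul_apply, Matrix.smul_apply, hA]
  | tensor f hf =>
    refine Finset.prod_congr rfl fun i _ => ?_
    by_cases hi : i ∈ S
    · rw [h i hi]
    · rw [hf i hi, one_apply_eq, one_apply_eq]

/-- In the Heisenberg picture, conjugation by `U` sends observables supported on `S` to observables
supported on `T`. -/
def HeisenbergMapsTo [StarRing 𝕜] (U : Matrix (ι → κ) (ι → κ) 𝕜) (S T : Finset ι) : Prop :=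
  ∀ A ∈ localAlgebra 𝕜 κ S, Uᴴ * A * U ∈ localAlgebra 𝕜 κ T

namespace HeisenbergMapsTo

variable [StarRing 𝕜] {U V : Matrix (ι → κ) (ι → κ) 𝕜} {S' T' R : Finset ι}

theorem one : HeisenbergMapsTo (1 : Matrix (ι → κ) (ι → κ) 𝕜) S S := fun A hA => by
  rwa [conjTranspose_one, Matrix.one_mul, Matrix.mul_one]

theorem mono (hU : HeisenbergMapsTo U S T) (hS : S' ⊆ S) (hT : T ⊆ T') :
    HeisenbergMapsTo U S' T' :=
  fun A hA => localAlgebra_mono hT (hU A (localAlgebra_mono hS hA))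

theorem mul (hV : HeisenbergMapsTo V S T) (hU : HeisenbergMapsTo U T R) :
    HeisenbergMapsTo (V * U) S R := fun A hA => by
  simpa only [conjTranspose_mul, Matrix.mul_assoc] using hU _ (hV A hA)

end HeisenbergMapsTo

theorem heisenbergMapsTo_tensorOp [StarRing 𝕜] {f : ι → Matrix κ κ 𝕜}
    (hf : ∀ i, (f i)ᴴ * f i = 1) (S : Finset ι) : HeisenbergMapsTo (tensorOp f) S S := by
  intro A hA
  induction hA using localAlgebra_induction with
  | zero => simp
  | add _ _ _ _ hA hB => simpa only [Matrix.mul_add, Matrix.add_mul] using add_mem hA hB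
  | smul c _ _ hA =>
    simpa only [Matrix.mul_smul, Matrix.smul_mul] using Subalgebra.smul_mem _ hA c
  | tensor g hg =>
    rw [tensorOp_conjTranspose, tensorOp_mul, tensorOp_mul]
    refine tensorOp_mem_localAlgebra fun i hi => ?_
    simpa [hg i hi] using hf i

variable (𝕜) in
/-- The projection onto the span of the basis strings whose letters on `S` are all equal to `b`. -/
def constProj (S : Finset ι) (b : κ) : Matrix (ι → κ) (ι → κ) 𝕜 :=
  diagonal fun y => if ∀ i ∈ S, y i = b then 1 else 0

omit [Fintype κ] in
theorem constProj_eq_tensorOp (S : Finset ι) (b : κ) :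
    constProj 𝕜 S b = tensorOp fun i => diagonal fun c => if i ∈ S → c = b then 1 else 0 := by
  simp only [tensorOp_diagonal, Finset.prod_ite_zero, Finset.prod_const_one, Finset.mem_univ,
    forall_const, constProj]

theorem constProj_mem_localAlgebra (S : Finset ι) (b : κ) :
    constProj 𝕜 S b ∈ localAlgebra 𝕜 κ S := by
  rw [constProj_eq_tensorOp]
  refine tensorOp_mem_localAlgebra fun i hi => ?_
  simp only [hi, IsEmpty.forall_iff, if_true, diagonal_one]

theorem trace_constProj (S : Finset ι) (b : κ) :
    (constProj 𝕜 S b : Matrix (ι → κ) (ι → κ) 𝕜).trace =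
      (Fintype.card κ : 𝕜) ^ (Fintype.card ι - S.card) := by
  have htrace (i : ι) : (diagonal fun c => if i ∈ S → c = b then (1 : 𝕜) else 0).trace =
      if i ∈ Sᶜ then (Fintype.card κ : 𝕜) else 1 := by
    by_cases hi : i ∈ S <;> simp [hi, trace_diagonal]
  rw [constProj_eq_tensorOp, trace_tensorOp]
  simp only [htrace, Finset.prod_ite_mem, Finset.univ_inter, Finset.prod_const, Finset.card_compl]

theorem conjTranspose_constProj_mul_self [StarRing 𝕜] (S : Finset ι) (b : κ) :
    (constProj 𝕜 S b)ᴴ * constProj 𝕜 S b = constProj 𝕜 S b := by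
  rw [constProj, diagonal_conjTranspose, diagonal_mul_diagonal]
  congr 1
  ext1 y
  rw [Pi.star_apply]
  split_ifs <;> simp only [star_one, star_zero, mul_one, mul_zero]

end TensorProducts

section CircuitOperators

variable {N d : ℕ}

namespace SingleLayer

theorem op_eq_tensorOp (L : SingleLayer N) :
    L.op = tensorOp fun i => (L i : Matrix (Fin 2) (Fin 2) ℂ) := rfl

theorem op_mem_unitaryGroup (L : SingleLayer N) : L.op ∈ unitaryGroup (Bits N) ℂ := by
  rw [mem_unitaryGroup_iff', star_eq_conjTranspose, op_eq_tensorOp, tensorOp_conjTranspose,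
    tensorOp_mul, ← tensorOp_one]
  exact congrArg tensorOp (funext fun i => UnitaryGroup.star_mul_self (L i))

theorem heisenbergMapsTo_op (L : SingleLayer N) (S : Finset (Fin N)) :
    HeisenbergMapsTo L.op S S :=
  heisenbergMapsTo_tensorOp (fun i => UnitaryGroup.star_mul_self (L i)) S

end SingleLayer

theorem czGate_eq_one_sub (S : Finset (Fin N)) : czGate S = 1 - (2 : ℂ) • constProj ℂ S 1 := by
  rw [czGate, constProj, ← diagonal_one, ← diagonal_smul, diagonal_sub]
  congr 1
  ext1 y
  rw [Pi.smul_apply]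
  split_ifs <;> norm_num

theorem czGate_mem_localAlgebra (S : Finset (Fin N)) : czGate S ∈ localAlgebra ℂ (Fin 2) S := by
  rw [czGate_eq_one_sub]
  exact sub_mem (one_mem _) (Subalgebra.smul_mem _ (constProj_mem_localAlgebra S 1) 2)

theorem conjTranspose_czGate (S : Finset (Fin N)) : (czGate S)ᴴ = czGate S := by
  rw [czGate, diagonal_conjTranspose]
  congr 1
  ext1 y
  rw [Pi.star_apply]
  split_ifs <;> simp only [star_neg, star_one]

theorem czGate_mul_self (S : Finset (Fin N)) : czGate S * czGate S = 1 := by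
  rw [czGate, diagonal_mul_diagonal, ← diagonal_one]
  congr 1
  ext1 y
  split_ifs <;> norm_num

theorem czGate_mem_unitaryGroup (S : Finset (Fin N)) : czGate S ∈ unitaryGroup (Bits N) ℂ := by
  rw [mem_unitaryGroup_iff', star_eq_conjTranspose, conjTranspose_czGate, czGate_mul_self]

theorem commute_czGate (S T : Finset (Fin N)) : Commute (czGate S) (czGate T) :=
  commute_diagonal _ _

theorem heisenbergMapsTo_czGate {R S : Finset (Fin N)} (h : S ⊆ R ∨ Disjoint R S) :
    HeisenbergMapsTo (czGate S) R R := by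
  intro A hA
  rw [conjTranspose_czGate]
  rcases h with hSR | hRS
  · have hS := localAlgebra_mono hSR (czGate_mem_localAlgebra S)
    exact mul_mem (mul_mem hS hA) hS
  · have hcomm := commute_of_mem_localAlgebra_of_disjoint hRS hA (czGate_mem_localAlgebra S)
    rwa [← hcomm.eq, Matrix.mul_assoc, czGate_mul_self, Matrix.mul_one]

theorem heisenbergMapsTo_prod_map_czGate {R T : Finset (Fin N)} (hRT : R ⊆ T)
    (gates : List (Finset (Fin N))) (h : ∀ S ∈ gates, S ⊆ T ∨ Disjoint R S) :
    HeisenbergMapsTo (gates.map czGate).prod R T := by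
  induction gates with
  | nil => exact HeisenbergMapsTo.one.mono subset_rfl hRT
  | cons S gates ih =>
    specialize ih fun S' hS' => h S' (List.mem_cons_of_mem S hS')
    rw [List.map_cons, List.prod_cons]
    rcases h S List.mem_cons_self with hST | hRS
    · have hcomm : Commute (czGate S) (gates.map czGate).prod :=
        Commute.list_prod_right _ _ (List.forall_mem_map.2 fun S' _ => commute_czGate S S')
      rw [hcomm.eq]
      exact ih.mul (heisenbergMapsTo_czGate (Or.inl hST))
    · exact (heisenbergMapsTo_czGate (Or.inr hRS)).mul ih

theorem CZLayer.op_mem_unitaryGroup (M : CZLayer N) : M.op ∈ unitaryGroup (Bits N) ℂ :=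
  list_prod_mem (List.forall_mem_map.2 fun S _ => czGate_mem_unitaryGroup S)

theorem OneDQAC.op_mem_unitaryGroup (C : OneDQAC N d) : C.op ∈ unitaryGroup (Bits N) ℂ := by
  induction C with
  | init L => exact L.op_mem_unitaryGroup
  | layer C M L ih => exact mul_mem (mul_mem L.op_mem_unitaryGroup M.op_mem_unitaryGroup) ih

end CircuitOperators

section Intervals

variable {N : ℕ}

/-- The qubits at the positions from `l` up to, but not including, `u`; positions beyond the end of
the line are ignored. -/
def qubitIco (N l u : ℕ) : Finset (Fin N) := {i | l ≤ i ∧ (i : ℕ) < u}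

theorem mem_qubitIco {l u : ℕ} {i : Fin N} : i ∈ qubitIco N l u ↔ l ≤ i ∧ (i : ℕ) < u := by
  simp only [qubitIco, Finset.mem_filter_univ]

theorem card_qubitIco {l u : ℕ} (h : u ≤ N) : (qubitIco N l u).card = u - l := by
  have hmap : (qubitIco N l u).map Fin.valEmbedding = Finset.Ico l u := by
    ext i
    simp only [Finset.mem_map, mem_qubitIco, Fin.valEmbedding_apply, Finset.mem_Ico]
    exact ⟨fun ⟨_, hj, hji⟩ => hji ▸ hj, fun hi => ⟨⟨i, hi.2.trans_le h⟩, hi, rfl⟩⟩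
  rw [← Finset.card_map Fin.valEmbedding, hmap, Nat.card_Ico]

theorem qubitIco_subset_qubitIco {l u l' u' : ℕ} (hl : l' ≤ l) (hu : u ≤ u') :
    qubitIco N l u ⊆ qubitIco N l' u' := fun i hi => by
  rw [mem_qubitIco] at hi ⊢
  omega

/-- `S` contains a window of `k` consecutive positions between `lo` and `hi`. -/
def ContainsWindow (lo hi k : ℕ) (S : Finset (Fin N)) : Prop :=
  ∃ t, lo ≤ t ∧ t + k ≤ hi ∧ qubitIco N t (t + k) ⊆ S

theorem subset_or_disjoint_of_not_containsWindow {lo hi k l u : ℕ} {p q : Fin N}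
    (h : ¬ContainsWindow lo hi k (Finset.Icc p q)) (hl : l = 0 ∨ lo + k ≤ l ∧ l ≤ hi)
    (hu : N ≤ u ∨ lo ≤ u ∧ u + k ≤ hi) :
    Finset.Icc p q ⊆ qubitIco N (l - k) (u + k) ∨
      Disjoint (qubitIco N l u) (Finset.Icc p q) := by
  by_contra! ⟨hsub, hdisj⟩
  obtain ⟨j, hj, hj'⟩ := Finset.not_subset.1 hsub
  obtain ⟨i, hi', hi⟩ := Finset.not_disjoint_iff.1 hdisj
  simp only [mem_qubitIco, Finset.mem_Icc, Fin.le_def, not_and_or, not_le, not_lt] at hi hi' hj hj'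
  have := j.isLt
  rcases hj' with hjl | hju
  · refine h ⟨l - k, by omega, by omega, fun v hv => ?_⟩
    simp only [mem_qubitIco, Finset.mem_Icc, Fin.le_def] at hv ⊢
    omega
  · refine h ⟨u, by omega, by omega, fun v hv => ?_⟩
    simp only [mem_qubitIco, Finset.mem_Icc, Fin.le_def] at hv ⊢
    omega

theorem length_le_card_of_pairwise_disjoint {α : Type*} {l : List (Finset α)} {T : Finset α}
    (hl : l.Pairwise Disjoint) (hT : ∀ S ∈ l, ¬Disjoint S T) : l.length ≤ T.card := by
  classical
  induction l generalizing T with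
  | nil => exact Nat.zero_le _
  | cons S l ih =>
    rw [List.pairwise_cons] at hl
    obtain ⟨i, hiS, hiT⟩ := Finset.not_disjoint_iff.1 (hT S List.mem_cons_self)
    have htail : l.length ≤ (T \ S).card := ih hl.2 fun S' hS' hdisj =>
      hT S' (List.mem_cons_of_mem S hS')
        (((hl.1 S' hS').symm.sup_right hdisj).mono_right le_sup_sdiff)
    have hlt : (T \ S).card < T.card := Finset.card_lt_card <|
      (Finset.ssubset_iff_of_subset Finset.sdiff_subset).2
        ⟨i, hiT, fun hi => (Finset.mem_sdiff.1 hi).2 hiS⟩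
    exact htail.trans_lt hlt

theorem IsContiguous.exists_map_univ_eq_qubitIco {n : ℕ} {e : Fin n ↪ Fin N} (he : IsContiguous e)
    (hn : 0 < n) : ∃ a, a + n ≤ N ∧ Finset.univ.map e = qubitIco N a (a + n) := by
  obtain ⟨p, r, hpr⟩ : ∃ p r, Finset.univ.map e = Finset.Icc p r := by
    have hne : (Finset.univ.map e).Nonempty := ⟨e ⟨0, hn⟩, Finset.mem_map_of_mem e (by simp)⟩
    have hrange (i : Fin N) : i ∈ Finset.univ.map e ↔ i ∈ Set.range e := by simp
    refine ⟨(Finset.univ.map e).min' hne, (Finset.univ.map e).max' hne, Finset.Subset.antisymm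
      (fun i hi => Finset.mem_Icc.2 ⟨Finset.min'_le _ i hi, Finset.le_max' _ i hi⟩) fun i hi => ?_⟩
    rw [hrange]
    exact he.out ((hrange _).1 (Finset.min'_mem _ hne)) ((hrange _).1 (Finset.max'_mem _ hne))
      (Finset.mem_Icc.1 hi)
  have hcard : (r : ℕ) + 1 - p = n := by
    rw [← Fin.card_Icc, ← hpr, Finset.card_map, Finset.card_univ, Fintype.card_fin]
  have := r.isLt
  refine ⟨p, by omega, ?_⟩
  ext i
  rw [hpr, mem_qubitIco, Finset.mem_Icc, Fin.le_def, Fin.le_def]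
  omega

end Intervals

section Pruning

variable {N d : ℕ}

open scoped Classical in
/-- The layer `M` without its gates that contain `k` consecutive positions between `lo` and `hi`. -/
noncomputable def CZLayer.prune (M : CZLayer N) (lo hi k : ℕ) : CZLayer N where
  gates := M.gates.filter (¬ContainsWindow lo hi k ·)
  interval S hS := M.interval S (List.mem_of_mem_filter hS)
  disjoint := M.disjoint.filter _

/-- The circuit `C` with the long gates inside `[a, b)` deleted, where the interval shrinks by `k`
positions at both ends with every layer. -/
noncomputable def OneDQAC.prune (a b k : ℕ) : {d : ℕ} → OneDQAC N d → OneDQAC N d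
  | _, .init L => .init L
  | d + 1, .layer C M L => .layer (C.prune a b k) (M.prune (a + d * k) (b - d * k) k) L

/-- In the Heisenberg picture `U` spreads observables on intervals of the line by at most `r`
positions on each side, provided that each end of the interval either is an end of the line or lies
in `[a, b)` at distance at least `r` from `a` and `b`. -/
def HasLightCone (U : QOp N) (a b r : ℕ) : Prop :=
  ∀ l u, (l = 0 ∨ a + r ≤ l ∧ l + r ≤ b) → (N ≤ u ∨ a + r ≤ u ∧ u + r ≤ b) →
    HeisenbergMapsTo U (qubitIco N l u) (qubitIco N (l - r) (u + r))

theorem CZLayer.heisenbergMapsTo_op_prune (M : CZLayer N) {lo hi k l u : ℕ}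
    (hl : l = 0 ∨ lo + k ≤ l ∧ l ≤ hi) (hu : N ≤ u ∨ lo ≤ u ∧ u + k ≤ hi) :
    HeisenbergMapsTo (M.prune lo hi k).op (qubitIco N l u) (qubitIco N (l - k) (u + k)) := by
  refine heisenbergMapsTo_prod_map_czGate
    (qubitIco_subset_qubitIco (Nat.sub_le l k) (Nat.le_add_right u k)) _ fun S hS => ?_
  obtain ⟨p, q, -, rfl⟩ := (M.prune lo hi k).interval S hS
  exact subset_or_disjoint_of_not_containsWindow (by simpa using (List.mem_filter.1 hS).2) hl hu

theorem OneDQAC.hasLightCone_op_prune (C : OneDQAC N d) (a b k : ℕ) :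
    HasLightCone (C.prune a b k).op a b (d * k) := by
  induction C with
  | init L =>
    rw [Nat.zero_mul]
    exact fun l u _ _ => L.heisenbergMapsTo_op _
  | @layer d C M L ih =>
    intro l u hl hu
    rw [Nat.succ_mul] at hl hu ⊢
    have hM := M.heisenbergMapsTo_op_prune (lo := a + d * k) (hi := b - d * k) (k := k) (l := l)
      (u := u) (by omega) (by omega)
    have hC := ih (l - k) (u + k) (by omega) (by omega)
    rw [Nat.sub_sub, Nat.add_assoc, Nat.add_comm k] at hC
    exact ((L.heisenbergMapsTo_op _).mul hM).mul hC

end Pruning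

section InitialStates

open scoped Matrix.Norms.Frobenius

variable {n N : ℕ} (e : Fin n ↪ Fin N) (φ : AncillaState e)

/-- The qubits of the line, sorted into input qubits and ancillas. -/
noncomputable def inputSumAncillaEquiv : Fin n ⊕ Ancilla e ≃ Fin N :=
  ((Equiv.ofInjective e e.injective).sumCongr (Equiv.refl _)).trans
    (Equiv.sumCompl (· ∈ Set.range e))

theorem prod_eq_prod_input_mul_prod_ancilla {M : Type*} [CommMonoid M] (g : Fin N → M) :
    ∏ q, g q = (∏ i, g (e i)) * ∏ q : Ancilla e, g q := by
  rw [← (inputSumAncillaEquiv e).prod_comp, Fintype.prod_sum_type]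
  rfl

theorem add_card_ancilla : n + Fintype.card (Ancilla e) = N := by
  simpa using Fintype.card_congr (inputSumAncillaEquiv e)

/-- The splitting of a basis string of the line into its restrictions to the input qubits and to the
ancillas. -/
noncomputable def bitsEquivProd : Bits N ≃ Bits n × (Ancilla e → Fin 2) :=
  ((inputSumAncillaEquiv e).symm.arrowCongr (Equiv.refl _)).trans
    (Equiv.sumArrowEquivProdArrow _ _ _)

theorem bitsEquivProd_symm_input (p : Bits n × (Ancilla e → Fin 2)) (i : Fin n) :
    (bitsEquivProd e).symm p (e i) = p.1 i :=
  congrFun (congrArg Prod.fst ((bitsEquivProd e).apply_symm_apply p)) i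

theorem bitsEquivProd_symm_ancilla (p : Bits n × (Ancilla e → Fin 2)) (q : Ancilla e) :
    (bitsEquivProd e).symm p q = p.2 q :=
  congrFun (congrArg Prod.snd ((bitsEquivProd e).apply_symm_apply p)) q

/-- The matrix whose columns are the initial states `|x⟩ ⊗ |φ⟩`, which lets the Frobenius norm
measure all inputs at once. -/
noncomputable def stateMatrix : Matrix (Bits N) (Bits n) ℂ :=
  Matrix.of fun y x => initialState e φ x y

theorem stateMatrix_apply_bitsEquivProd_symm (x x' : Bits n) (u : Ancilla e → Fin 2) :
    stateMatrix e φ ((bitsEquivProd e).symm (x', u)) x = if x' = x then φ u else 0 := by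
  simp only [stateMatrix, of_apply, initialState, bitsEquivProd_symm_input,
    bitsEquivProd_symm_ancilla, funext_iff]

theorem mul_stateMatrix_apply {m : Type*} (A : Matrix m (Bits N) ℂ) (i : m) (x : Bits n) :
    (A * stateMatrix e φ) i x = ∑ u, A i ((bitsEquivProd e).symm (x, u)) * φ u := by
  rw [mul_apply, ← (bitsEquivProd e).symm.sum_comp, Fintype.sum_prod_type, Finset.sum_comm]
  simp only [stateMatrix_apply_bitsEquivProd_symm, mul_ite, mul_zero, Finset.sum_ite_eq',
    Finset.mem_univ, if_true]

theorem conjTranspose_stateMatrix_mul_apply {m : Type*} (A : Matrix (Bits N) m ℂ) (x : Bits n)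
    (j : m) :
    ((stateMatrix e φ)ᴴ * A) x j = ∑ u, star (φ u) * A ((bitsEquivProd e).symm (x, u)) j := by
  rw [← conjTranspose_conjTranspose A, ← conjTranspose_mul, conjTranspose_apply,
    mul_stateMatrix_apply, star_sum]
  simp only [star_mul, conjTranspose_apply]

theorem conj_tensorOp_stateMatrix (f : Fin N → Matrix (Fin 2) (Fin 2) ℂ) :
    (stateMatrix e φ)ᴴ * tensorOp f * stateMatrix e φ =
      (star ⇑φ ⬝ᵥ tensorOp (fun q : Ancilla e => f q) *ᵥ φ) • tensorOp (f ∘ e) := by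
  ext x x'
  rw [Matrix.mul_assoc, conjTranspose_stateMatrix_mul_apply, Matrix.smul_apply, smul_eq_mul,
    dotProduct, Finset.sum_mul]
  refine Finset.sum_congr rfl fun u _ => ?_
  rw [mul_stateMatrix_apply, mulVec, dotProduct, Pi.star_apply, mul_assoc, Finset.sum_mul]
  congr 1
  refine Finset.sum_congr rfl fun u' _ => ?_
  simp only [tensorOp_apply, prod_eq_prod_input_mul_prod_ancilla e, bitsEquivProd_symm_input,
    bitsEquivProd_symm_ancilla, Function.comp_apply]
  ring

theorem conj_stateMatrix_mem_localAlgebra {S : Finset (Fin N)} {B : QOp N}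
    (hB : B ∈ localAlgebra ℂ (Fin 2) S) :
    (stateMatrix e φ)ᴴ * B * stateMatrix e φ ∈
      localAlgebra ℂ (Fin 2) (S.preimage e e.injective.injOn) := by
  induction hB using localAlgebra_induction with
  | zero => simp only [Matrix.mul_zero, Matrix.zero_mul, zero_mem]
  | add _ _ _ _ hA hB => simpa only [Matrix.mul_add, Matrix.add_mul] using add_mem hA hB
  | smul c _ _ hA =>
    simpa only [Matrix.mul_smul, Matrix.smul_mul] using Subalgebra.smul_mem _ hA c
  | tensor f hf =>
    rw [conj_tensorOp_stateMatrix]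
    exact Subalgebra.smul_mem _ (tensorOp_mem_localAlgebra fun i hi =>
      hf _ fun hS => hi (Finset.mem_preimage.2 hS)) _

variable {e φ}

theorem AncillaState.star_dotProduct_self (hφ : ‖φ‖ = 1) : star ⇑φ ⬝ᵥ φ = 1 := by
  rw [dotProduct_comm, ← EuclideanSpace.inner_eq_star_dotProduct, inner_self_eq_norm_sq_to_K, hφ,
    RCLike.ofReal_one, one_pow]

theorem conjTranspose_stateMatrix_mul_self (hφ : ‖φ‖ = 1) :
    (stateMatrix e φ)ᴴ * stateMatrix e φ = 1 := by
  have h := conj_tensorOp_stateMatrix e φ 1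
  have hone : tensorOp ((1 : Fin N → Matrix (Fin 2) (Fin 2) ℂ) ∘ e) = 1 := tensorOp_one
  have hone' : tensorOp (fun q : Ancilla e => (1 : Fin N → Matrix (Fin 2) (Fin 2) ℂ) q) = 1 :=
    tensorOp_one
  rwa [hone, hone', tensorOp_one, Matrix.mul_one, one_mulVec, AncillaState.star_dotProduct_self hφ,
    one_smul] at h

theorem trace_mul_eq_of_mem_localAlgebra (hφ : ‖φ‖ = 1) {B : QOp N}
    (hB : B ∈ localAlgebra ℂ (Fin 2) (Finset.univ.map e)) :
    2 ^ n * B.trace = 2 ^ N * ((stateMatrix e φ)ᴴ * B * stateMatrix e φ).trace := by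
  induction hB using localAlgebra_induction with
  | zero => simp only [Matrix.mul_zero, Matrix.zero_mul, trace_zero, mul_zero]
  | add _ _ _ _ hA hB => rw [Matrix.mul_add, Matrix.add_mul, trace_add, trace_add, mul_add, mul_add,
      hA, hB]
  | smul c _ _ hA => rw [Matrix.mul_smul, Matrix.smul_mul, trace_smul, trace_smul, mul_smul_comm,
      mul_smul_comm, hA]
  | tensor f hf =>
    have hancilla (q : Ancilla e) : f q = 1 := hf q (by simpa using q.2)
    have hone : tensorOp (fun q : Ancilla e => f q) = 1 := by
      rw [funext hancilla]
      exact tensorOp_one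
    rw [conj_tensorOp_stateMatrix, hone, one_mulVec, AncillaState.star_dotProduct_self hφ, one_smul,
      trace_tensorOp, trace_tensorOp, prod_eq_prod_input_mul_prod_ancilla e]
    simp only [hancilla, trace_one, Finset.prod_const, Finset.card_univ, Fintype.card_fin,
      Function.comp_apply]
    have hpow : (2 : ℂ) ^ N = 2 ^ n * 2 ^ Fintype.card (Ancilla e) := by
      rw [← pow_add, add_card_ancilla]
    rw [hpow, Nat.cast_ofNat]
    ring

/-- A unitary `U` whose light cone from `W` stays on the input qubits leaves `W` in the
maximally mixed state when the input is uniformly random. -/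
theorem frobenius_norm_constProj_mul_stateMatrix_sq (hφ : ‖φ‖ = 1) {U : QOp N}
    (hU : U ∈ unitaryGroup (Bits N) ℂ) {W : Finset (Fin N)}
    (hW : HeisenbergMapsTo U W (Finset.univ.map e)) (b : Fin 2) :
    ‖constProj ℂ W b * (U * stateMatrix e φ)‖ ^ 2 = 2 ^ n / 2 ^ W.card := by
  set Ψ := stateMatrix e φ
  set P : QOp N := constProj ℂ W b
  have hconj : (P * (U * Ψ))ᴴ * (P * (U * Ψ)) = Ψᴴ * (Uᴴ * P * U) * Ψ :=
    calc (P * (U * Ψ))ᴴ * (P * (U * Ψ)) = (U * Ψ)ᴴ * (Pᴴ * P) * (U * Ψ) := by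
          simp only [conjTranspose_mul P, Matrix.mul_assoc]
      _ = Ψᴴ * (Uᴴ * P * U) * Ψ := by
          rw [conjTranspose_constProj_mul_self, conjTranspose_mul]
          simp only [Matrix.mul_assoc, P]
  have htrace : (Uᴴ * P * U).trace = 2 ^ (N - W.card) := by
    rw [trace_mul_cycle, ← star_eq_conjTranspose, mem_unitaryGroup_iff.1 hU, Matrix.one_mul,
      trace_constProj, Fintype.card_fin, Fintype.card_fin, Nat.cast_ofNat]
  have h := trace_mul_eq_of_mem_localAlgebra hφ (hW P (constProj_mem_localAlgebra W b))
  rw [htrace, ← hconj, trace_conjTranspose_mul_self_eq_frobenius_norm_sq] at h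
  have hpow : (2 : ℝ) ^ N = 2 ^ (N - W.card) * 2 ^ W.card := by
    rw [← pow_add, Nat.sub_add_cancel (card_finset_fin_le W)]
  have hreal : (2 : ℝ) ^ n * 2 ^ (N - W.card) = 2 ^ N * ‖P * (U * Ψ)‖ ^ 2 :=
    Complex.ofReal_injective (by push_cast; simpa using h)
  rw [eq_div_iff (by positivity)]
  refine mul_left_cancel₀ (pow_ne_zero (N - W.card) (two_ne_zero (α := ℝ))) ?_
  linear_combination -hreal - ‖P * (U * Ψ)‖ ^ 2 * hpow

theorem frobenius_norm_czGate_sub_one_mul_le {m : Type*} [Fintype m] {S W : Finset (Fin N)}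
    (hWS : W ⊆ S) (A : Matrix (Bits N) m ℂ) :
    ‖(czGate S - 1) * A‖ ≤ 2 * ‖constProj ℂ W (1 : Fin 2) * A‖ := by
  have hS : (czGate S - 1) * A = -(2 : ℂ) • (constProj ℂ S (1 : Fin 2) * A) := by
    rw [czGate_eq_one_sub, sub_sub_cancel_left, ← neg_smul, Matrix.smul_mul]
  rw [hS, norm_smul, norm_neg, Complex.norm_ofNat]
  gcongr
  refine frobenius_norm_le_of_forall_norm_le fun y x => ?_
  rw [constProj, constProj, diagonal_mul, diagonal_mul]
  split_ifs with hyS hyW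
  · exact le_rfl
  · exact absurd (fun i hi => hyS i (hWS hi)) hyW
  all_goals simp

end InitialStates

section PruningError

open scoped Matrix.Norms.Frobenius

variable {n N d a k : ℕ} {e : Fin n ↪ Fin N} {φ : AncillaState e}

theorem frobenius_norm_czGate_sub_one_mul_stateMatrix_le (hφ : ‖φ‖ = 1) {U : QOp N}
    (hU : U ∈ unitaryGroup (Bits N) ℂ) {S W : Finset (Fin N)} (hWS : W ⊆ S)
    (hW : HeisenbergMapsTo U W (Finset.univ.map e)) :
    ‖(czGate S - 1) * (U * stateMatrix e φ)‖ ≤ 2 * √(2 ^ n / 2 ^ W.card) := by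
  rw [← frobenius_norm_constProj_mul_stateMatrix_sq hφ hU hW 1, Real.sqrt_sq (norm_nonneg _)]
  exact frobenius_norm_czGate_sub_one_mul_le hWS _

theorem CZLayer.frobenius_norm_op_sub_op_prune_mul_le {m : Type*} [Fintype m] (M : CZLayer N)
    {lo hi : ℕ} (hk : 0 < k) (hN : hi ≤ N) (A : Matrix (Bits N) m ℂ) {δ : ℝ} (hδ₀ : 0 ≤ δ)
    (hδ : ∀ S : Finset (Fin N), ContainsWindow lo hi k S → ‖(czGate S - 1) * A‖ ≤ δ) :
    ‖(M.op - (M.prune lo hi k).op) * A‖ ≤ (hi - lo : ℕ) * δ := by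
  classical
  have hcount : M.gates.countP (ContainsWindow lo hi k ·) ≤ hi - lo := by
    rw [List.countP_eq_length_filter, ← card_qubitIco (l := lo) hN]
    refine length_le_card_of_pairwise_disjoint (M.disjoint.filter _) fun S hS => ?_
    obtain ⟨t, hlo, hhi, hsub⟩ : ContainsWindow lo hi k S := by
      simpa using (List.mem_filter.1 hS).2
    refine Finset.not_disjoint_iff.2 ⟨⟨t, by omega⟩, hsub ?_, ?_⟩ <;> simp only [mem_qubitIco] <;>
      omega
  calc ‖(M.op - (M.prune lo hi k).op) * A‖
      ≤ M.gates.countP (ContainsWindow lo hi k ·) * δ :=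
        frobenius_norm_prod_sub_prod_filter_mul_le czGate_mem_unitaryGroup commute_czGate _ A
          M.gates fun S _ => hδ S
    _ ≤ (hi - lo : ℕ) * δ := by gcongr

theorem OneDQAC.frobenius_norm_op_sub_op_prune_mul_le (C : OneDQAC N d) (hφ : ‖φ‖ = 1)
    (haN : a + n ≤ N) (he : Finset.univ.map e = qubitIco N a (a + n)) (hk : 0 < k) :
    ‖(C.op - (C.prune a (a + n) k).op) * stateMatrix e φ‖ ≤ d * (n * (2 * √(2 ^ n / 2 ^ k))) := by
  induction C with
  | init L => simp [OneDQAC.prune]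
  | @layer d C M L ih =>
    set Ψ := stateMatrix e φ
    set δ := 2 * √((2 : ℝ) ^ n / 2 ^ k)
    set C' := C.prune a (a + n) k
    set M' := M.prune (a + d * k) (a + n - d * k) k
    have hgate (S : Finset (Fin N)) (hS : ContainsWindow (a + d * k) (a + n - d * k) k S) :
        ‖(czGate S - 1) * (C'.op * Ψ)‖ ≤ δ := by
      obtain ⟨t, hlo, hhi, hsub⟩ := hS
      have hW : HeisenbergMapsTo C'.op (qubitIco N t (t + k)) (Finset.univ.map e) := he ▸
        (C.hasLightCone_op_prune a (a + n) k t (t + k) (by omega) (by omega)).mono subset_rfl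
          (qubitIco_subset_qubitIco (by omega) (by omega))
      have h := frobenius_norm_czGate_sub_one_mul_stateMatrix_le hφ C'.op_mem_unitaryGroup hsub hW
      rwa [card_qubitIco (by omega), Nat.add_sub_cancel_left] at h
    have hlayer : ‖(M.op - M'.op) * (C'.op * Ψ)‖ ≤ n * δ := by
      refine
        (M.frobenius_norm_op_sub_op_prune_mul_le hk (by omega) _ (by positivity) hgate).trans ?_
      gcongr
      omega
    calc ‖((C.layer M L).op - ((C.layer M L).prune a (a + n) k).op) * Ψ‖
        = ‖L.op * (M.op * ((C.op - C'.op) * Ψ) + (M.op - M'.op) * (C'.op * Ψ))‖ := by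
          congr 1
          simp only [OneDQAC.prune, OneDQAC.op, Matrix.mul_sub, Matrix.sub_mul, Matrix.mul_assoc,
            sub_add_sub_cancel, C', M']
      _ ≤ ‖(C.op - C'.op) * Ψ‖ + ‖(M.op - M'.op) * (C'.op * Ψ)‖ := by
          rw [frobenius_norm_unitary_mul L.op_mem_unitaryGroup,
            ← frobenius_norm_unitary_mul M.op_mem_unitaryGroup ((C.op - C'.op) * Ψ)]
          exact norm_add_le _ _
      _ ≤ d * (n * δ) + n * δ := add_le_add ih hlayer
      _ = (d + 1 : ℕ) * (n * δ) := by push_cast; ring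

end PruningError

section SuccessProbability

open scoped Matrix.Norms.Frobenius

variable {n N d : ℕ}

/-- The restriction of a family of states, one column for each input, to the amplitudes at which the
output qubit `q` holds the parity of the input. -/
def parityPart (q : Fin N) (G : Matrix (Bits N) (Bits n) ℂ) : Matrix (Bits N) (Bits n) ℂ :=
  Matrix.of fun y x => if y q = parity x then G y x else 0

theorem parityPart_sub (q : Fin N) (G H : Matrix (Bits N) (Bits n) ℂ) :
    parityPart q (G - H) = parityPart q G - parityPart q H := by
  ext y x
  simp only [parityPart, Matrix.sub_apply, of_apply]
  split_ifs <;> simp only [sub_zero]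

theorem frobenius_norm_parityPart_le (q : Fin N) (G : Matrix (Bits N) (Bits n) ℂ) :
    ‖parityPart q G‖ ≤ ‖G‖ := by
  refine frobenius_norm_le_of_forall_norm_le fun y x => ?_
  rw [parityPart, of_apply]
  split_ifs <;> simp only [le_refl, norm_zero, norm_nonneg]

theorem frobenius_norm_parityPart_sq (q : Fin N) (G : Matrix (Bits N) (Bits n) ℂ) :
    ‖parityPart q G‖ ^ 2 = ∑ x, measureProb (G.col x) q (parity x) := by
  rw [frobenius_norm_sq, Finset.sum_comm]
  refine Finset.sum_congr rfl fun x _ => ?_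
  rw [measureProb, Finset.sum_filter]
  refine Finset.sum_congr rfl fun y _ => ?_
  rw [parityPart, of_apply]
  split_ifs <;> simp

theorem frobenius_norm_parityPart_sq_sub_le (q : Fin N) (G H : Matrix (Bits N) (Bits n) ℂ) :
    ‖parityPart q G‖ ^ 2 - ‖parityPart q H‖ ^ 2 ≤ ‖G - H‖ * (‖G‖ + ‖H‖) := by
  have hsub : ‖parityPart q G‖ - ‖parityPart q H‖ ≤ ‖G - H‖ :=
    calc ‖parityPart q G‖ - ‖parityPart q H‖ ≤ ‖parityPart q G - parityPart q H‖ :=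
          norm_sub_norm_le _ _
      _ = ‖parityPart q (G - H)‖ := by rw [parityPart_sub]
      _ ≤ ‖G - H‖ := frobenius_norm_parityPart_le q _
  calc ‖parityPart q G‖ ^ 2 - ‖parityPart q H‖ ^ 2
      = (‖parityPart q G‖ - ‖parityPart q H‖) * (‖parityPart q G‖ + ‖parityPart q H‖) := by ring
    _ ≤ ‖G - H‖ * (‖G‖ + ‖H‖) := by
      gcongr <;> exact frobenius_norm_parityPart_le q _

theorem measureProb_col_eq (G : Matrix (Bits N) (Bits n) ℂ) (q : Fin N) (b : Fin 2) (x : Bits n) :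
    (measureProb (G.col x) q b : ℂ) = (Gᴴ * constProj ℂ {q} b * G) x x := by
  rw [mul_apply, measureProb, Finset.sum_filter, Complex.ofReal_sum]
  refine Finset.sum_congr rfl fun y _ => ?_
  simp only [constProj, mul_diagonal, conjTranspose_apply, Finset.mem_singleton, forall_eq]
  split_ifs
  · rw [mul_one, ← starRingEnd_apply, Complex.conj_mul', Complex.ofReal_pow, col_apply]
  · rw [mul_zero, zero_mul, Complex.ofReal_zero]

theorem measureProb_zero_add_measureProb_one (ψ : Bits N → ℂ) (q : Fin N) :
    measureProb ψ q 0 + measureProb ψ q 1 = ∑ y, ‖ψ y‖ ^ 2 := by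
  rw [← Fin.sum_univ_two (measureProb ψ q)]
  exact Finset.sum_fiberwise Finset.univ (fun y : Bits N => y q) _

theorem parity_update_add_one (x : Bits n) (i : Fin n) :
    parity (Function.update x i (x i + 1)) = parity x + 1 := by
  rw [parity, parity, Finset.sum_update_of_mem (Finset.mem_univ i),
    ← Finset.add_sum_erase _ _ (Finset.mem_univ i), Finset.sdiff_singleton_eq_erase]
  abel

theorem sum_apply_parity_eq_half_of_update_invariant (p : Fin 2 → Bits n → ℝ) (i : Fin n)
    (hinv : ∀ b x, p b (Function.update x i (x i + 1)) = p b x) :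
    ∑ x, p (parity x) x = (∑ x, (p 0 x + p 1 x)) / 2 := by
  have hbit (b : Fin 2) : b + 1 + 1 = b := by fin_cases b <;> rfl
  have hinvol : Function.Involutive fun x : Bits n => Function.update x i (x i + 1) := fun x => by
    simp only [Function.update_self, Function.update_idem, hbit, Function.update_eq_self]
  have hflip : ∑ x, p (parity x + 1) x = ∑ x, p (parity x) x := by
    rw [← Equiv.sum_comp hinvol.toPerm fun x => p (parity x) x]
    simp only [hinvol.coe_toPerm, hinv, parity_update_add_one]
  have hpair (b : Fin 2) (x : Bits n) : p 0 x + p 1 x = p b x + p (b + 1) x := by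
    fin_cases b
    · rfl
    · exact add_comm _ _
  rw [Finset.sum_congr rfl fun x _ => hpair (parity x) x, Finset.sum_add_distrib, hflip]
  ring

variable {e : Fin n ↪ Fin N} {φ : AncillaState e}

theorem frobenius_norm_stateMatrix (hφ : ‖φ‖ = 1) : ‖stateMatrix e φ‖ = √(2 ^ n) := by
  rw [← Real.sqrt_sq (norm_nonneg (stateMatrix e φ)),
    frobenius_norm_sq_of_isometry (conjTranspose_stateMatrix_mul_self hφ)]
  simp

theorem frobenius_norm_parityPart_sq_of_heisenbergMapsTo (hφ : ‖φ‖ = 1) {U : QOp N}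
    (hU : U ∈ unitaryGroup (Bits N) ℂ) {q : Fin N} {T : Finset (Fin N)}
    (hT : HeisenbergMapsTo U {q} T) {i : Fin n} (hi : e i ∉ T) :
    ‖parityPart q (U * stateMatrix e φ)‖ ^ 2 = 2 ^ n / 2 := by
  set G := U * stateMatrix e φ
  have hinv (b : Fin 2) (x : Bits n) :
      measureProb (G.col (Function.update x i (x i + 1))) q b = measureProb (G.col x) q b := by
    have hlocal := conj_stateMatrix_mem_localAlgebra e φ
      (hT _ (constProj_mem_localAlgebra {q} b))
    have hconj : Gᴴ * constProj ℂ {q} b * G =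
        (stateMatrix e φ)ᴴ * (Uᴴ * constProj ℂ {q} b * U) * stateMatrix e φ := by
      simp only [G, conjTranspose_mul, Matrix.mul_assoc]
    refine Complex.ofReal_injective ?_
    rw [measureProb_col_eq, measureProb_col_eq, hconj]
    refine apply_self_congr_of_mem_localAlgebra hlocal fun j hj => ?_
    refine Function.update_of_ne ?_ _ _
    rintro rfl
    exact hi (Finset.mem_preimage.1 hj)
  have htotal : ∑ x, (measureProb (G.col x) q 0 + measureProb (G.col x) q 1) = 2 ^ n := by
    simp only [measureProb_zero_add_measureProb_one, col_apply]
    rw [Finset.sum_comm, ← frobenius_norm_sq, frobenius_norm_unitary_mul hU,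
      frobenius_norm_stateMatrix hφ, Real.sq_sqrt (by positivity)]
  rw [frobenius_norm_parityPart_sq,
    sum_apply_parity_eq_half_of_update_invariant (fun b x => measureProb (G.col x) q b) i hinv,
    htotal]

theorem exists_heisenbergMapsTo_notMem_of_hasLightCone {U : QOp N} {a r : ℕ}
    (hU : HasLightCone U a (a + n) r) (haN : a + n ≤ N)
    (he : Finset.univ.map e = qubitIco N a (a + n)) (hr : 2 * r + 2 ≤ n) (q : Fin N) :
    ∃ T, HeisenbergMapsTo U {q} T ∧ ∃ i, e i ∉ T := by
  have hinput (p : ℕ) (hp : p < N) (hap : a ≤ p) (hpn : p < a + n) : ∃ i, e i = ⟨p, hp⟩ := by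
    have hmem : (⟨p, hp⟩ : Fin N) ∈ Finset.univ.map e := he ▸ mem_qubitIco.2 ⟨hap, hpn⟩
    simpa using hmem
  by_cases hq : (q : ℕ) < a + n - 1 - r
  · obtain ⟨i, hi⟩ := hinput (a + n - 1) (by omega) (by omega) (by omega)
    have hcone := hU 0 (a + n - 1 - r) (Or.inl rfl) (Or.inr (by omega))
    refine ⟨_, hcone.mono ?_ subset_rfl, i, ?_⟩
    · rw [Finset.singleton_subset_iff, mem_qubitIco]
      exact ⟨Nat.zero_le _, hq⟩
    · rw [hi, mem_qubitIco]
      dsimp only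
      omega
  · obtain ⟨i, hi⟩ := hinput a (by omega) le_rfl (by omega)
    have hcone := hU (a + 1 + r) N (Or.inr (by omega)) (Or.inl le_rfl)
    refine ⟨_, hcone.mono ?_ subset_rfl, i, ?_⟩
    · rw [Finset.singleton_subset_iff, mem_qubitIco]
      exact ⟨by omega, q.isLt⟩
    · rw [hi, mem_qubitIco]
      dsimp only
      omega

theorem paritySuccess_eq (C : OneDQAC N d) (e : Fin n ↪ Fin N) (φ : AncillaState e) (q : Fin N) :
    paritySuccess C e φ q = ‖parityPart q (C.op * stateMatrix e φ)‖ ^ 2 / 2 ^ n := by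
  rw [paritySuccess, frobenius_norm_parityPart_sq]
  rfl

theorem paritySuccess_le_one (C : OneDQAC N d) (hφ : ‖φ‖ = 1) (q : Fin N) :
    paritySuccess C e φ q ≤ 1 := by
  rw [paritySuccess_eq, div_le_one (by positivity)]
  calc ‖parityPart q (C.op * stateMatrix e φ)‖ ^ 2 ≤ ‖C.op * stateMatrix e φ‖ ^ 2 := by
        gcongr
        exact frobenius_norm_parityPart_le q _
    _ = 2 ^ n := by
      rw [frobenius_norm_unitary_mul C.op_mem_unitaryGroup, frobenius_norm_stateMatrix hφ,
        Real.sq_sqrt (by positivity)]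

theorem paritySuccess_sub_le {d' : ℕ} (C : OneDQAC N d) (C' : OneDQAC N d') (hφ : ‖φ‖ = 1)
    (q : Fin N) :
    paritySuccess C e φ q - paritySuccess C' e φ q ≤
      2 * ‖(C.op - C'.op) * stateMatrix e φ‖ / √(2 ^ n) := by
  have h := frobenius_norm_parityPart_sq_sub_le q (C.op * stateMatrix e φ)
    (C'.op * stateMatrix e φ)
  rw [frobenius_norm_unitary_mul C.op_mem_unitaryGroup,
    frobenius_norm_unitary_mul C'.op_mem_unitaryGroup, frobenius_norm_stateMatrix hφ,
    ← Matrix.sub_mul] at h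
  have hsq : (2 : ℝ) ^ n = √(2 ^ n) * √(2 ^ n) := (Real.mul_self_sqrt (by positivity)).symm
  rw [paritySuccess_eq, paritySuccess_eq, ← sub_div]
  calc _ ≤ ‖(C.op - C'.op) * stateMatrix e φ‖ * (√(2 ^ n) + √(2 ^ n)) / 2 ^ n := by gcongr
    _ = 2 * ‖(C.op - C'.op) * stateMatrix e φ‖ / √(2 ^ n) := by
      rw [div_eq_div_iff (by positivity) (by positivity)]
      linear_combination (-2 * ‖(C.op - C'.op) * stateMatrix e φ‖) * hsq

theorem paritySuccess_prune {a k : ℕ} (C : OneDQAC N d) (hφ : ‖φ‖ = 1) (haN : a + n ≤ N)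
    (he : Finset.univ.map e = qubitIco N a (a + n)) (hd : 2 * (d * k) + 2 ≤ n) (q : Fin N) :
    paritySuccess (C.prune a (a + n) k) e φ q = 1 / 2 := by
  obtain ⟨T, hT, i, hi⟩ := exists_heisenbergMapsTo_notMem_of_hasLightCone
    (C.hasLightCone_op_prune a (a + n) k) haN he hd q
  rw [paritySuccess_eq, frobenius_norm_parityPart_sq_of_heisenbergMapsTo hφ
    (C.prune a (a + n) k).op_mem_unitaryGroup hT hi]
  field_simp

theorem paritySuccess_le {k : ℕ} (C : OneDQAC N d) (he : IsContiguous e) (hφ : ‖φ‖ = 1)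
    (q : Fin N) (hk : 0 < k) (hd : 2 * (d * k) + 2 ≤ n) :
    paritySuccess C e φ q ≤ 1 / 2 + 4 * d * n * (√(2 ^ k))⁻¹ := by
  obtain ⟨a, haN, hrange⟩ := he.exists_map_univ_eq_qubitIco (by omega)
  calc paritySuccess C e φ q
      = paritySuccess (C.prune a (a + n) k) e φ q +
        (paritySuccess C e φ q - paritySuccess (C.prune a (a + n) k) e φ q) := by ring
    _ ≤ 1 / 2 + 2 * (d * (n * (2 * √(2 ^ n / 2 ^ k)))) / √(2 ^ n) := by
      gcongr
      · exact (paritySuccess_prune C hφ haN hrange hd q).le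
      · refine (paritySuccess_sub_le C _ hφ q).trans ?_
        gcongr
        exact C.frobenius_norm_op_sub_op_prune_mul_le hφ haN hrange hk
    _ = 1 / 2 + 4 * d * n * (√(2 ^ k))⁻¹ := by
      rw [Real.sqrt_div (by positivity)]
      field_simp
      ring

end SuccessProbability

section DepthBound

theorem two_mul_mul_ceil_add_two_le {n d : ℕ} (hd : 0 < d) (h : 10 * d < n) :
    2 * (d * ⌈(n : ℝ) / (5 * d)⌉₊) + 2 ≤ n := by
  have hd' : (1 : ℝ) ≤ d := by exact_mod_cast hd
  have h' : (10 : ℝ) * d < n := by exact_mod_cast h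
  have hceil : (d : ℝ) * ⌈(n : ℝ) / (5 * d)⌉₊ ≤ n / 5 + d :=
    calc (d : ℝ) * ⌈(n : ℝ) / (5 * d)⌉₊ ≤ d * (n / (5 * d) + 1) := by
          gcongr
          exact (Nat.ceil_lt_add_one (by positivity)).le
      _ = n / 5 + d := by field_simp
  have hreal : (2 * (d * ⌈(n : ℝ) / (5 * d)⌉₊) + 2 : ℝ) ≤ n := by linarith
  exact_mod_cast hreal

theorem inv_sqrt_two_pow_ceil_le (n d : ℝ) :
    (√((2 : ℝ) ^ ⌈n / (5 * d)⌉₊))⁻¹ ≤ 2 ^ (-(n / (10 * d))) := by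
  rw [Real.sqrt_eq_rpow, ← Real.rpow_natCast, ← Real.rpow_mul zero_le_two,
    ← Real.rpow_neg zero_le_two]
  refine Real.rpow_le_rpow_of_exponent_le one_le_two (neg_le_neg ?_)
  calc n / (10 * d) = n / (5 * d) * (1 / 2) := by
        rw [div_mul_div_comm]
        ring_nf
    _ ≤ ⌈n / (5 * d)⌉₊ * (1 / 2) := by
      gcongr
      exact Nat.le_ceil _

theorem log_two_div_mul_div_log_le {n d : ℝ} (hn : 2 ≤ n) (hd : 1 ≤ d)
    (h : 2 / 3 ≤ 1 / 2 + 8 * d * n * 2 ^ (-(n / (10 * d)))) :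
    Real.log 2 / 80 * (n / Real.log n) ≤ d := by
  have hlog2 : 0 < Real.log 2 := Real.log_pos one_lt_two
  have hlogn : Real.log 2 ≤ Real.log n := Real.log_le_log two_pos hn
  rw [← mul_div_assoc, div_le_iff₀ (by linarith)]
  rcases le_or_gt n d with hnd | hdn
  · rw [mul_comm d]
    exact mul_le_mul (by linarith) hnd (by linarith) (by linarith)
  have hpow : (2 : ℝ) ^ (n / (10 * d)) ≤ n ^ 8 := by
    have hpos : (0 : ℝ) < 2 ^ (n / (10 * d)) := by positivity
    have hsixth : 1 / 6 ≤ 8 * d * n / 2 ^ (n / (10 * d)) := by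
      rw [Real.rpow_neg zero_le_two, ← div_eq_mul_inv] at h
      linarith
    have h48 : (48 : ℝ) ≤ n ^ 6 :=
      calc (48 : ℝ) ≤ 2 ^ 6 := by norm_num
        _ ≤ n ^ 6 := by gcongr
    rw [le_div_iff₀ hpos] at hsixth
    calc (2 : ℝ) ^ (n / (10 * d)) ≤ 48 * d * n := by linarith
      _ ≤ n ^ 6 * n * n := by gcongr
      _ = n ^ 8 := by ring
  have hlog := Real.log_le_log (by positivity) hpow
  rw [Real.log_rpow two_pos, Real.log_pow, div_mul_eq_mul_div, div_le_iff₀ (by positivity)] at hlog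
  push_cast at hlog
  linarith

variable {n N d : ℕ} {e : Fin n ↪ Fin N} {φ : AncillaState e}

theorem paritySuccess_le_half_add_rpow (C : OneDQAC N d) (he : IsContiguous e) (hφ : ‖φ‖ = 1)
    (q : Fin N) (hn : 1 ≤ n) (hd : 1 ≤ d) :
    paritySuccess C e φ q ≤ 1 / 2 + 8 * d * n * (2 : ℝ) ^ (-((n : ℝ) / (10 * d))) := by
  have hd' : (1 : ℝ) ≤ d := by exact_mod_cast hd
  rcases lt_or_ge (10 * d) n with hlarge | hsmall
  · calc paritySuccess C e φ q
        ≤ 1 / 2 + 4 * d * n * (√(2 ^ ⌈(n : ℝ) / (5 * d)⌉₊))⁻¹ :=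
          paritySuccess_le C he hφ q (Nat.ceil_pos.2 (by positivity))
            (two_mul_mul_ceil_add_two_le hd hlarge)
      _ ≤ 1 / 2 + 8 * d * n * (2 : ℝ) ^ (-((n : ℝ) / (10 * d))) := by
        gcongr
        · norm_num
        · exact inv_sqrt_two_pow_ceil_le n d
  · have hn' : (1 : ℝ) ≤ n := by exact_mod_cast hn
    have hdn : (1 : ℝ) ≤ d * n := one_le_mul_of_one_le_of_one_le hd' hn'
    have hsmall' : (n : ℝ) ≤ 10 * d := by exact_mod_cast hsmall
    have hexp : (2 : ℝ)⁻¹ ≤ 2 ^ (-((n : ℝ) / (10 * d))) := by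
      rw [← Real.rpow_neg_one]
      refine Real.rpow_le_rpow_of_exponent_le one_le_two (neg_le_neg ?_)
      exact div_le_one_of_le₀ hsmall' (by positivity)
    calc paritySuccess C e φ q ≤ 1 := paritySuccess_le_one C hφ q
      _ ≤ 1 / 2 + 8 * d * n * 2⁻¹ := by linarith
      _ ≤ 1 / 2 + 8 * d * n * (2 : ℝ) ^ (-((n : ℝ) / (10 * d))) := by gcongr

theorem depth_pos_of_half_lt_paritySuccess (C : OneDQAC N d) (he : IsContiguous e) (hφ : ‖φ‖ = 1)
    {q : Fin N} (hn : 2 ≤ n) (hs : 1 / 2 < paritySuccess C e φ q) : 0 < d := by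
  rw [Nat.pos_iff_ne_zero]
  rintro rfl
  have h := paritySuccess_le C he hφ q zero_lt_one (by omega)
  rw [Nat.cast_zero, mul_zero, zero_mul, zero_mul, add_zero] at h
  exact hs.not_ge h

end DepthBound

theorem mainTheorem3 :
    (∀ (n d N : ℕ) (C : OneDQAC N d) (e : Fin n ↪ Fin N) (φ : AncillaState e) (q : Fin N),
      1 ≤ n → 1 ≤ d → IsContiguous e → ‖φ‖ = 1 →
        paritySuccess C e φ q ≤
          1 / 2 + 8 * (d : ℝ) * (n : ℝ) * (2 : ℝ) ^ (-((n : ℝ) / (10 * (d : ℝ))))) ∧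
    (∃ c : ℝ, 0 < c ∧
      ∀ (n d N : ℕ) (C : OneDQAC N d) (e : Fin n ↪ Fin N) (φ : AncillaState e) (q : Fin N),
        2 ≤ n → IsContiguous e → ‖φ‖ = 1 → 2 / 3 ≤ paritySuccess C e φ q →
          c * ((n : ℝ) / Real.log (n : ℝ)) ≤ (d : ℝ)) := by
  refine ⟨fun n d N C e φ q hn hd he hφ => paritySuccess_le_half_add_rpow C he hφ q hn hd,
    Real.log 2 / 80, div_pos (Real.log_pos one_lt_two) (by norm_num),
    fun n d N C e φ q hn he hφ hs => ?_⟩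
  have hd : 1 ≤ d := depth_pos_of_half_lt_paritySuccess C he hφ hn (hs.trans_lt' (by norm_num))
  exact log_two_div_mul_div_log_le (by exact_mod_cast hn) (by exact_mod_cast hd)
    (hs.trans (paritySuccess_le_half_add_rpow C he hφ q (by omega) hd))
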